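/- Let $n\ge 1$ be an integer, let $Q=2n+2$ be the homogeneous dimension of the Heisenberg group $\mathbb H^n$, whose points are written in logarithmic coordinates as $(z,\sigma)\in\mathbb R^{2n}\times\mathbb R$, and let $1<p<Q$. Let $N(z,\sigma)=(|z|^4+16|\sigma|^2)^{1/4}$ be the Korányi–Folland gauge and, for $t>0$, let $$G_p((z,\sigma),t)=t^{-\frac{Q+p-2}{2(p-1)}}\int_{\mathbb R}e^{-\frac{i}{(p-1)t}\sigma\lambda}\left(\frac{|\lambda|}{\sinh|\lambda|}\right)^{\frac{Q-p}{2(p-1)}}e^{-\frac{|z|^2}{4(p-1)t}\frac{|\lambda|}{\tanh|\lambda|}}\,d\lambda .$$ Put $\alpha=\frac{Q-p}{2(p-1)}$ and $$C_{n,p}=2^{3\alpha-1}(p-1)^{\alpha}\,\Gamma\!\left(\frac{\alpha}{2}\right)^2>0 .$$ Then for every $(z,\sigma)\neq(0,0)$ the integral defining $G_p((z,\sigma),t)$ converges absolutely for all $t>0$, the function $t\mapsto G_p((z,\sigma),t)$ is absolutely integrable on $(0,\infty)$, and $$\int_0^\infty G_p((z,\sigma),t)\,dt=C_{n,p}\,N(z,\sigma)^{-\frac{Q-p}{p-1}}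 .$$ -/

import Mathlib

open MeasureTheory Set

noncomputable section

namespace Heisenberg

/-- The horizontal layer `ℝ²ⁿ` of the Heisenberg group `ℍⁿ`, with its Euclidean norm. A point of
`ℍⁿ` is written in logarithmic coordinates as a pair `(z, σ)` with `z` in this space and `σ` in the
one-dimensional vertical layer `ℝ`. -/
abbrev Horizontal (n : ℕ) : Type := EuclideanSpace ℝ (Fin (2 * n))

/-- The homogeneous dimension `Q = 2n + 2` of `ℍⁿ`. -/
def homDim (n : ℕ) : ℝ := 2 * (n : ℝ) + 2

/-- The Korányi-Folland gauge `N(z, σ) = (|z|⁴ + 16 |σ|²)^(1/4)`. -/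
def gauge {n : ℕ} (z : Horizontal n) (σ : ℝ) : ℝ :=
  (‖z‖ ^ 4 + 16 * |σ| ^ 2) ^ ((1 : ℝ) / 4)

/-- The integrand (in the dual variable `l`) of the Fourier integral defining the kernel `G_p`.
At the single point `l = 0` the quotients `|l| / sinh |l|` and `|l| / tanh |l|` should be read as
their limit `1`; Lean assigns them the value `0` there, which does not affect any integral over
`l`. -/
def kernelIntegrand {n : ℕ} (p : ℝ) (z : Horizontal n) (σ t l : ℝ) : ℂ :=
  Complex.exp (-(Complex.I / (((p - 1) * t : ℝ) : ℂ)) * ((σ * l : ℝ) : ℂ))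
    * (((|l| / Real.sinh |l|) ^ ((homDim n - p) / (2 * (p - 1))) : ℝ) : ℂ)
    * ((Real.exp (-(‖z‖ ^ 2 / (4 * (p - 1) * t)) * (|l| / Real.tanh |l|)) : ℝ) : ℂ)

/-- The kernel `G_p((z, σ), t)`, for `t > 0` and `1 < p < Q`. -/
def kernel {n : ℕ} (p : ℝ) (z : Horizontal n) (σ t : ℝ) : ℂ :=
  ((t ^ (-((homDim n + p - 2) / (2 * (p - 1)))) : ℝ) : ℂ) * ∫ l : ℝ, kernelIntegrand p z σ t l

/-- The constant `C_{n,p} = 2^(3α - 1) (p - 1)^α Γ(α / 2)²` with `α = (Q - p) / (2 (p - 1))`. -/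
def potentialConst (n : ℕ) (p : ℝ) : ℝ :=
  2 ^ (3 * ((homDim n - p) / (2 * (p - 1))) - 1)
    * (p - 1) ^ ((homDim n - p) / (2 * (p - 1)))
    * Real.Gamma ((homDim n - p) / (2 * (p - 1)) / 2) ^ 2

end Heisenberg

end

/-!
Write `|z|² + 4 i σ = R e^{iθ}`; its modulus is `R = N(z, σ)²` and `|θ| ≤ π / 2`. Put
`r = R / (4 (p - 1))` and let `sinhc w = sinh w / w`. Since
`|z|² cosh l + 4 i σ sinh l = R cosh (l + iθ)`, the Fourier integrand of `G_p` is
`sinhc(l)^{-α} exp (-r cosh (l + iθ) / (t sinhc l))`. It is holomorphic and decays in the strip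
`|Im l| ≤ π / 2`, so the line of integration can be moved to `l = x - iθ`, where the numerator
`r cosh x` of the exponent is real. The integral over `t` is now a Gamma integral equal to
`Γ(α) (r cosh x / sinhc l)^{-α}`, whose power of `sinhc l` cancels the prefactor. What remains,
`Γ(α) ∫ (r cosh x)^{-α} dx`, is a Beta integral after the substitution `s = 1 / (1 + e^{-x})`.
-/

namespace Heisenberg

open Complex Filter Topology
open scoped Real ComplexConjugate Interval

noncomputable section

section Sinhc

lemma re_cosh (w : ℂ) : (cosh w).re = Real.cosh w.re * Real.cos w.im := by
  conv_lhs => rw [← re_add_im w, cosh_add, cosh_mul_I, sinh_mul_I]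
  simp [← ofReal_cosh, ← ofReal_cos, ← ofReal_sinh, ← ofReal_sin]

lemma norm_cosh_le (w : ℂ) : ‖cosh w‖ ≤ Real.cosh w.re := by
  calc ‖cosh w‖ = ‖exp w + exp (-w)‖ / 2 := by simp [cosh]
    _ ≤ (‖exp w‖ + ‖exp (-w)‖) / 2 := by gcongr; exact norm_add_le _ _
    _ = Real.cosh w.re := by simp [norm_exp, Real.cosh_eq]

lemma mul_sinh_nonneg (x : ℝ) : 0 ≤ x * Real.sinh x := by
  rcases le_total 0 x with h | h
  · exact mul_nonneg h (Real.sinh_nonneg_iff.2 h)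
  · exact mul_nonneg_of_nonpos_of_nonpos h (Real.sinh_nonpos_iff.2 h)

lemma mul_sin_nonneg {y : ℝ} (hy : |y| ≤ π) : 0 ≤ y * Real.sin y := by
  obtain ⟨h1, h2⟩ := abs_le.1 hy
  rcases le_total 0 y with h | h
  · exact mul_nonneg h (Real.sin_nonneg_of_nonneg_of_le_pi h h2)
  · exact mul_nonneg_of_nonpos_of_nonpos h (Real.sin_nonpos_of_nonpos_of_neg_pi_le h h1)

/-- The entire function `sinh w / w`, with the removable singularity at `0` filled in. -/
def sinhc : ℂ → ℂ := dslope sinh 0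

lemma sinhc_of_ne_zero {w : ℂ} (hw : w ≠ 0) : sinhc w = sinh w / w := by
  simp [sinhc, dslope_of_ne _ hw, slope_def_field]

lemma sinhc_mul_self (w : ℂ) : sinhc w * w = sinh w := by
  rcases eq_or_ne w 0 with rfl | hw
  · simp
  · rw [sinhc_of_ne_zero hw, div_mul_cancel₀ _ hw]

lemma differentiable_sinhc : Differentiable ℂ sinhc := by
  rw [← differentiableOn_univ, sinhc, differentiableOn_dslope univ_mem]
  exact differentiable_sinh.differentiableOn

lemma sinhc_eq_integral (w : ℂ) : sinhc w = ∫ s in (0 : ℝ)..1, cosh (s * w) := by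
  rcases eq_or_ne w 0 with rfl | hw
  · simp [sinhc, dslope_same]
  · have h := intervalIntegral.integral_unitInterval_deriv_eq_sub (z₀ := (0 : ℂ)) (z₁ := w)
      (f := sinh) (f' := cosh) (by fun_prop) fun s _ => hasDerivAt_sinh _
    rw [sinhc_of_ne_zero hw, eq_comm, eq_div_iff hw]
    simpa [mul_comm] using h

lemma re_sinhc (w : ℂ) :
    (sinhc w).re = ∫ s in (0 : ℝ)..1, Real.cosh (s * w.re) * Real.cos (s * w.im) := by
  have h := intervalIntegral.intervalIntegral_re (f := fun s : ℝ => cosh (s * w)) (μ := volume)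
    (Continuous.intervalIntegrable (by fun_prop) 0 1)
  simpa [sinhc_eq_integral, re_cosh] using h.symm

lemma norm_sinhc_le (w : ℂ) : ‖sinhc w‖ ≤ Real.cosh w.re := by
  have h : ∀ s ∈ Ι (0 : ℝ) 1, ‖cosh (s * w)‖ ≤ Real.cosh w.re := fun s hs => by
    rw [uIoc_of_le zero_le_one] at hs
    refine (norm_cosh_le _).trans (Real.cosh_le_cosh.2 ?_)
    rw [re_ofReal_mul, abs_mul, abs_of_pos hs.1]
    exact mul_le_of_le_one_left (abs_nonneg _) hs.2
  simpa [sinhc_eq_integral] using intervalIntegral.norm_integral_le_of_norm_le_const h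

lemma one_sub_le_cos_mul {s y : ℝ} (hs : s ∈ Icc (0 : ℝ) 1) (hy : |y| ≤ π / 2) :
    1 - s ≤ Real.cos (s * y) := by
  have h : |s * y| ≤ s * (π / 2) := by
    rw [abs_mul, abs_of_nonneg hs.1]
    exact mul_le_mul_of_nonneg_left hy hs.1
  calc 1 - s = 1 - 2 / π * (s * (π / 2)) := by field_simp
    _ ≤ 1 - 2 / π * |s * y| := by gcongr
    _ ≤ Real.cos |s * y| := Real.one_sub_mul_le_cos (abs_nonneg _) (h.trans
      (mul_le_of_le_one_left (by positivity) hs.2))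
    _ = Real.cos (s * y) := Real.cos_abs _

lemma cosh_half_le_re_sinhc {w : ℂ} (hw : |w.im| ≤ π / 2) :
    Real.cosh (w.re / 2) / 8 ≤ (sinhc w).re := by
  have hcos : ∀ s ∈ Icc (0 : ℝ) 1, 1 - s ≤ Real.cos (s * w.im) := fun s hs =>
    one_sub_le_cos_mul hs hw
  have hint : ∀ a b : ℝ, IntervalIntegrable
      (fun s => Real.cosh (s * w.re) * Real.cos (s * w.im)) volume a b := fun a b =>
    Continuous.intervalIntegrable (by fun_prop) a b
  calc Real.cosh (w.re / 2) / 8 = ∫ s in (1 / 2 : ℝ)..1, Real.cosh (w.re / 2) * (1 - s) := by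
        rw [intervalIntegral.integral_const_mul,
          intervalIntegral.integral_comp_sub_left (fun s => s) (1 : ℝ), integral_id]
        ring
    _ ≤ ∫ s in (1 / 2 : ℝ)..1, Real.cosh (s * w.re) * Real.cos (s * w.im) := by
        refine intervalIntegral.integral_mono_on (by norm_num)
          (Continuous.intervalIntegrable (by fun_prop) _ _) (hint _ _) fun s hs => ?_
        refine mul_le_mul (Real.cosh_le_cosh.2 ?_) (hcos s ⟨by linarith [hs.1], hs.2⟩)
          (sub_nonneg.2 hs.2) (Real.cosh_pos _).le
        rw [div_eq_inv_mul, abs_mul, abs_mul, abs_of_pos (by norm_num : (0 : ℝ) < 2⁻¹)]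
        exact mul_le_mul_of_nonneg_right (by simpa using hs.1.trans (le_abs_self s)) (abs_nonneg _)
    _ ≤ ∫ s in (0 : ℝ)..1, Real.cosh (s * w.re) * Real.cos (s * w.im) :=
        intervalIntegral.integral_mono_interval (by norm_num) (by norm_num) le_rfl
          ((ae_restrict_mem measurableSet_Ioc).mono fun s hs => mul_nonneg (Real.cosh_pos _).le
            ((sub_nonneg.2 hs.2).trans (hcos s ⟨hs.1.le, hs.2⟩))) (hint _ _)
    _ = (sinhc w).re := (re_sinhc w).symm

lemma re_sinhc_pos {w : ℂ} (hw : |w.im| ≤ π / 2) : 0 < (sinhc w).re :=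
  (by positivity : 0 < Real.cosh (w.re / 2) / 8).trans_le (cosh_half_le_re_sinhc hw)

lemma sinhc_ne_zero {w : ℂ} (hw : |w.im| ≤ π / 2) : sinhc w ≠ 0 := fun h =>
  (re_sinhc_pos hw).ne' (by simp [h])

lemma cosh_mul_conj_sinh (w : ℂ) :
    cosh w * conj (sinh w) = (Real.sinh (2 * w.re) - Real.sin (2 * w.im) * I) / 2 := by
  have hadd : ((2 * w.re : ℝ) : ℂ) = w + conj w := (add_conj w).symm
  have hsub : ((2 * w.im : ℝ) : ℂ) * I = w - conj w := (sub_conj w).symm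
  rw [ofReal_sinh, ofReal_sin, ← sinh_mul_I, hadd, hsub, sinh_add, sinh_sub, sinh_conj]
  ring

lemma re_cosh_div_sinhc_nonneg {w : ℂ} (hw : |w.im| ≤ π / 2) :
    0 ≤ (cosh w / sinhc w).re := by
  rcases eq_or_ne w 0 with rfl | h0
  · simp [sinhc, dslope_same]
  have hfrac : cosh w / sinhc w = w * (cosh w * conj (sinh w)) / normSq (sinh w) := by
    rw [sinhc_of_ne_zero h0, div_div_eq_mul_div, div_eq_mul_inv, inv_def, ofReal_inv]
    ring
  have hre : (w * (cosh w * conj (sinh w))).re =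
      (w.re * Real.sinh (2 * w.re) + w.im * Real.sin (2 * w.im)) / 2 := by
    rw [cosh_mul_conj_sinh, ← mul_div_assoc, div_ofNat_re]
    simp [-ofReal_sinh, -ofReal_sin]
  rw [hfrac, div_ofReal_re, hre]
  have hsinh := mul_sinh_nonneg (2 * w.re)
  have hsin := mul_sin_nonneg (y := 2 * w.im) (by rw [abs_mul, abs_two]; linarith)
  exact div_nonneg (by linarith) (normSq_nonneg _)

end Sinhc

section ContourShift

variable {E : Type*} [NormedAddCommGroup E] {f : ℂ → E} {y : ℝ} {B : ℝ → ℝ}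

lemma integrable_comp_add_mul_I (hf : ContinuousOn f (im ⁻¹' [[0, y]]))
    (hB : ∀ w, w.im ∈ [[0, y]] → ‖f w‖ ≤ B w.re) (hBi : Integrable B) {v : ℝ}
    (hv : v ∈ [[0, y]]) : Integrable fun x : ℝ => f (x + v * I) := by
  have hcont : Continuous fun x : ℝ => f (x + v * I) :=
    hf.comp_continuous (by fun_prop) fun x => by simpa using hv
  exact hBi.mono' hcont.aestronglyMeasurable
    (ae_of_all _ fun x => by simpa using hB (x + v * I) (by simpa using hv))

variable [NormedSpace ℂ E]

lemma intervalIntegral_sub_intervalIntegral_add_mul_I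
    (hf : DifferentiableOn ℂ f (im ⁻¹' [[0, y]])) (a b : ℝ) :
    (∫ x in a..b, f x) - ∫ x in a..b, f (x + y * I) =
      I • (∫ v in (0 : ℝ)..y, f (a + v * I)) - I • ∫ v in (0 : ℝ)..y, f (b + v * I) := by
  have h := integral_boundary_rect_eq_zero_of_differentiableOn f (a : ℂ) (b + y * I)
    (hf.mono fun w hw => by simpa using hw.2)
  simp only [ofReal_re, ofReal_im, add_re, mul_re, I_re, I_im, add_im, mul_im, mul_zero, mul_one,
    zero_mul, sub_self, add_zero, zero_add, ofReal_zero] at h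
  rw [← sub_eq_zero, ← h]
  abel

lemma tendsto_intervalIntegral_vertical (hB : ∀ w, w.im ∈ [[0, y]] → ‖f w‖ ≤ B w.re)
    (hB0 : Tendsto B (cocompact ℝ) (𝓝 0)) :
    Tendsto (fun a : ℝ => ∫ v in (0 : ℝ)..y, f (a + v * I)) (cocompact ℝ) (𝓝 0) := by
  refine squeeze_zero_norm (a := fun a => B a * |y - 0|) (fun a => ?_)
    (by simpa using hB0.mul_const |y - 0|)
  refine intervalIntegral.norm_integral_le_of_norm_le_const fun v hv => ?_
  simpa using hB (a + v * I) (by simpa using uIoc_subset_uIcc hv)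

lemma integral_eq_integral_add_mul_I (hf : DifferentiableOn ℂ f (im ⁻¹' [[0, y]]))
    (hB : ∀ w, w.im ∈ [[0, y]] → ‖f w‖ ≤ B w.re) (hBi : Integrable B)
    (hB0 : Tendsto B (cocompact ℝ) (𝓝 0)) :
    ∫ x : ℝ, f x = ∫ x : ℝ, f (x + y * I) := by
  have hvert := tendsto_intervalIntegral_vertical hB hB0
  rw [cocompact_eq_atBot_atTop] at hvert
  have hvert0 : Tendsto (fun T : ℝ => (∫ x in (-T)..T, f x) - ∫ x in (-T)..T, f (x + y * I))
      atTop (𝓝 0) := by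
    simp_rw [intervalIntegral_sub_intervalIntegral_add_mul_I hf]
    simpa using (((hvert.mono_left le_sup_left).comp tendsto_neg_atTop_atBot).const_smul I).sub
      ((hvert.mono_left le_sup_right).const_smul I)
  have hbot : Integrable fun x : ℝ => f x := by
    simpa using integrable_comp_add_mul_I hf.continuousOn hB hBi left_mem_uIcc
  have htop := integrable_comp_add_mul_I hf.continuousOn hB hBi right_mem_uIcc
  have hlim := (intervalIntegral_tendsto_integral hbot tendsto_neg_atTop_atBot tendsto_id).sub
    (intervalIntegral_tendsto_integral htop tendsto_neg_atTop_atBot tendsto_id)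
  exact sub_eq_zero.1 (tendsto_nhds_unique hlim hvert0)

end ContourShift

section Mellin

variable {s w : ℂ}

lemma integrableOn_rpow_mul_exp_neg_mul {a b : ℝ} (ha : -1 < a) (hb : 0 < b) :
    IntegrableOn (fun t : ℝ => t ^ a * Real.exp (-(b * t))) (Ioi 0) := by
  simpa using integrableOn_rpow_mul_exp_neg_mul_rpow ha one_pos hb

lemma norm_cpow_mul_cexp_neg_mul {t : ℝ} (ht : 0 < t) (s w : ℂ) :
    ‖(t : ℂ) ^ s * cexp (-(w * t))‖ = t ^ s.re * Real.exp (-(w.re * t)) := by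
  simp [norm_exp, norm_cpow_eq_rpow_re_of_pos ht]

lemma mellinConvergent_cexp_neg_mul (hs : 0 < s.re) (hw : 0 < w.re) :
    MellinConvergent (fun t => cexp (-(w * t))) s := by
  have h := integrableOn_rpow_mul_exp_neg_mul (a := (s - 1).re) (by simpa using hs) hw
  exact h.mono' (Measurable.aestronglyMeasurable (by fun_prop)) <|
    (ae_restrict_mem measurableSet_Ioi).mono fun t ht => (norm_cpow_mul_cexp_neg_mul ht _ w).le

lemma differentiableAt_mellin_cexp_neg_mul (hs : 0 < s.re) (hw : 0 < w.re) :
    DifferentiableAt ℂ (fun v => mellin (fun t => cexp (-(v * t))) s) w := by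
  have hmem : {v : ℂ | w.re / 2 < v.re} ∈ 𝓝 w :=
    (isOpen_lt continuous_const continuous_re).mem_nhds (by simpa using hw)
  have hbound : ∀ t ∈ Ioi (0 : ℝ), ∀ v ∈ {v : ℂ | w.re / 2 < v.re},
      ‖(t : ℂ) ^ (s - 1) * (cexp (-(v * t)) * -t)‖ ≤ t ^ s.re * Real.exp (-(w.re / 2 * t)) := by
    intro t (ht : 0 < t) v (hv : w.re / 2 < v.re)
    rw [← mul_assoc, norm_mul, norm_cpow_mul_cexp_neg_mul ht, norm_neg, norm_real,
      Real.norm_of_nonneg ht.le, mul_right_comm, sub_re, one_re, Real.rpow_sub_one ht.ne',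
      div_mul_cancel₀ _ ht.ne']
    gcongr
  refine (hasDerivAt_integral_of_dominated_loc_of_deriv_le (μ := volume.restrict (Ioi (0 : ℝ)))
    (F := fun v t => (t : ℂ) ^ (s - 1) • cexp (-(v * t)))
    (F' := fun v t => (t : ℂ) ^ (s - 1) * (cexp (-(v * t)) * -t))
    (bound := fun t => t ^ s.re * Real.exp (-(w.re / 2 * t))) hmem
    (Eventually.of_forall fun v => Measurable.aestronglyMeasurable (by fun_prop))
    (mellinConvergent_cexp_neg_mul hs hw) (Measurable.aestronglyMeasurable (by fun_prop))
    ((ae_restrict_mem measurableSet_Ioi).mono hbound)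
    (integrableOn_rpow_mul_exp_neg_mul (by linarith) (by linarith))
    (ae_of_all _ fun t v _ => ?_)).2.differentiableAt
  simpa using ((((hasDerivAt_id v).mul_const (t : ℂ)).neg.cexp).const_mul ((t : ℂ) ^ (s - 1)))

lemma mellin_cexp_neg_mul_ofReal (hs : 0 < s.re) {r : ℝ} (hr : 0 < r) :
    mellin (fun t => cexp (-(r * t))) s = (r : ℂ) ^ (-s) * Gamma s := by
  have hinv : (r : ℂ)⁻¹ ^ s = (r : ℂ) ^ (-s) := by
    rw [inv_cpow _ _ (by simpa [arg_ofReal_of_nonneg hr.le] using Real.pi_ne_zero.symm),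
      cpow_neg]
  simpa [mellin, hinv] using integral_cpow_mul_exp_neg_mul_Ioi hs hr

-- Both sides are holomorphic in `w` on the right half-plane and agree on the positive reals.
lemma hasMellin_cexp_neg_mul (hs : 0 < s.re) (hw : 0 < w.re) :
    HasMellin (fun t => cexp (-(w * t))) s (w ^ (-s) * Gamma s) := by
  refine ⟨mellinConvergent_cexp_neg_mul hs hw, ?_⟩
  have hopen : IsOpen {v : ℂ | 0 < v.re} := isOpen_lt continuous_const continuous_re
  have hleft : AnalyticOnNhd ℂ (fun v => mellin (fun t => cexp (-(v * t))) s) {v | 0 < v.re} :=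
    DifferentiableOn.analyticOnNhd (fun v hv =>
      (differentiableAt_mellin_cexp_neg_mul hs hv).differentiableWithinAt) hopen
  have hright : AnalyticOnNhd ℂ (fun v : ℂ => v ^ (-s) * Gamma s) {v | 0 < v.re} :=
    DifferentiableOn.analyticOnNhd (fun v hv =>
      ((differentiableAt_id.cpow_const (Or.inl hv)).mul_const _).differentiableWithinAt) hopen
  have hreal : ∃ᶠ v in 𝓝[≠] (1 : ℂ),
      mellin (fun t => cexp (-(v * t))) s = v ^ (-s) * Gamma s := by
    have htend : Tendsto (fun r : ℝ => (r : ℂ)) (𝓝[≠] 1) (𝓝[≠] 1) :=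
      (continuous_ofReal.tendsto' 1 1 ofReal_one).inf (by simp)
    refine htend.frequently (Eventually.frequently ?_)
    filter_upwards [nhdsWithin_le_nhds (lt_mem_nhds (zero_lt_one' ℝ))] with r hr
      using mellin_cexp_neg_mul_ofReal hs hr
  exact hleft.eqOn_of_preconnected_of_frequently_eq hright
    (convex_halfSpace_re_gt 0).isPreconnected (by simp) hreal hw

lemma hasMellin_cexp_neg_div (hs : 0 < s.re) (hw : 0 < w.re) :
    HasMellin (fun t => cexp (-(w / t))) (-s) (w ^ (-s) * Gamma s) := by
  obtain ⟨hconv, heq⟩ := hasMellin_cexp_neg_mul hs hw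
  have hinv := mellin_comp_inv (fun t => cexp (-(w * t))) (-s)
  simp only [ofReal_inv, ← div_eq_mul_inv, neg_neg] at hinv
  refine ⟨?_, hinv.trans heq⟩
  have := MellinConvergent.comp_rpow (f := fun t => cexp (-(w * t))) (s := -s) (a := -1) (by simp)
  simpa [Real.rpow_neg_one, div_eq_mul_inv] using this.2 (by simpa using hconv)

lemma integral_norm_cpow_smul_cexp_neg_div (hs : 0 < s.re) (hw : 0 < w.re) :
    ∫ t in Ioi (0 : ℝ), ‖(t : ℂ) ^ (-s - 1) • cexp (-(w / t))‖ =
      w.re ^ (-s.re) * Real.Gamma s.re := by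
  have hnorm : ∀ t ∈ Ioi (0 : ℝ), (‖(t : ℂ) ^ (-s - 1) • cexp (-(w / t))‖ : ℂ) =
      (t : ℂ) ^ (-(s.re : ℂ) - 1) • cexp (-((w.re : ℂ) / t)) := fun t (ht : 0 < t) => by
    rw [norm_smul, norm_cpow_eq_rpow_re_of_pos ht, norm_exp, ofReal_mul, ofReal_cpow ht.le]
    simp
  have hmellin := (hasMellin_cexp_neg_div (s := s.re) (w := w.re) (by simpa) (by simpa)).2
  rw [mellin, ← setIntegral_congr_fun measurableSet_Ioi hnorm, integral_complex_ofReal,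
    Gamma_ofReal, ← ofReal_neg, ← ofReal_cpow hw.le, ← ofReal_mul] at hmellin
  exact ofReal_injective hmellin

lemma hasMellin_integral {X E : Type*} [MeasurableSpace X] {μ : Measure X} [SFinite μ]
    [NormedAddCommGroup E] [NormedSpace ℂ E] {f : ℝ → X → E} {m : X → E} {B : X → ℝ}
    (hf : AEStronglyMeasurable (Function.uncurry f) ((volume.restrict (Ioi 0)).prod μ))
    (hm : ∀ x, HasMellin (f · x) s (m x)) (hBi : Integrable B μ)
    (hB : ∀ x, ∫ t in Ioi (0 : ℝ), ‖(t : ℂ) ^ (s - 1) • f t x‖ ≤ B x) :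
    HasMellin (fun t => ∫ x, f t x ∂μ) s (∫ x, m x ∂μ) := by
  have hcpow : Measurable fun q : ℝ × X => (q.1 : ℂ) ^ (s - 1) := by fun_prop
  have hmeas := hcpow.aestronglyMeasurable.smul hf
  have hprod : Integrable (fun q : ℝ × X => (q.1 : ℂ) ^ (s - 1) • f q.1 q.2)
      ((volume.restrict (Ioi 0)).prod μ) := by
    refine (integrable_prod_iff' hmeas).2 ⟨ae_of_all _ fun x => (hm x).1, ?_⟩
    refine hBi.mono' hmeas.norm.prod_swap.integral_prod_right' (ae_of_all _ fun x => ?_)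
    rw [Real.norm_of_nonneg (integral_nonneg fun t => norm_nonneg _)]
    exact hB x
  constructor
  · simpa only [MellinConvergent, IntegrableOn, integral_smul] using hprod.integral_prod_left
  · simp_rw [← fun x => (hm x).2, mellin, ← integral_smul]
    exact integral_integral_swap hprod

end Mellin

section Beta

variable {u v : ℂ}

lemma sigmoid_mul_one_sub_sigmoid (x : ℝ) :
    Real.sigmoid x * (1 - Real.sigmoid x) = ((2 * Real.cosh (x / 2)) ^ 2)⁻¹ := by
  have hcosh : (2 * Real.cosh (x / 2)) ^ 2 = (1 + Real.exp (-x)) * (1 + Real.exp x) := by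
    have hexp : Real.exp (-x) * Real.exp x = 1 := by rw [← Real.exp_add]; simp
    have hsq : Real.cosh x = 2 * Real.cosh (x / 2) ^ 2 - 1 := by
      rw [← mul_div_cancel₀ x two_ne_zero, Real.cosh_two_mul, Real.sinh_sq]
      ring_nf
    rw [Real.cosh_eq] at hsq
    linear_combination -2 * hsq - hexp
  rw [← Real.sigmoid_neg, Real.sigmoid_def, Real.sigmoid_def, neg_neg, hcosh, mul_inv]

lemma betaIntegrand_comp_sigmoid (u v : ℂ) (x : ℝ) :
    |Real.sigmoid x * (1 - Real.sigmoid x)| •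
        ((Real.sigmoid x : ℂ) ^ (u - 1) * (1 - (Real.sigmoid x : ℂ)) ^ (v - 1)) =
      (Real.sigmoid x : ℂ) ^ u * (1 - (Real.sigmoid x : ℂ)) ^ v := by
  have hpos := Real.sigmoid_pos x
  have hlt := Real.sigmoid_lt_one x
  have hne : (Real.sigmoid x : ℂ) ≠ 0 := ofReal_ne_zero.2 hpos.ne'
  have hne' : (1 - Real.sigmoid x : ℂ) ≠ 0 := by
    exact_mod_cast (sub_pos.2 hlt).ne'
  rw [abs_of_pos (mul_pos hpos (sub_pos.2 hlt)), cpow_sub _ _ hne, cpow_sub _ _ hne', cpow_one,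
    cpow_one, real_smul]
  push_cast
  field_simp

lemma integrable_sigmoid_cpow_mul (hu : 0 < u.re) (hv : 0 < v.re) :
    Integrable fun x : ℝ => (Real.sigmoid x : ℂ) ^ u * (1 - (Real.sigmoid x : ℂ)) ^ v := by
  have h := (intervalIntegrable_iff_integrableOn_Ioo_of_le zero_le_one).1
    (betaIntegral_convergent hu hv)
  rw [← Real.range_sigmoid, ← image_univ, integrableOn_image_iff_integrableOn_abs_deriv_smul
    MeasurableSet.univ (fun x _ => (Real.hasDerivAt_sigmoid x).hasDerivWithinAt)
    Real.sigmoid_injective.injOn] at h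
  simpa only [betaIntegrand_comp_sigmoid, integrableOn_univ] using h

lemma integral_sigmoid_cpow_mul (u v : ℂ) :
    ∫ x : ℝ, (Real.sigmoid x : ℂ) ^ u * (1 - (Real.sigmoid x : ℂ)) ^ v = betaIntegral u v := by
  rw [betaIntegral, intervalIntegral.integral_of_le zero_le_one, integral_Ioc_eq_integral_Ioo,
    ← Real.range_sigmoid, ← image_univ, integral_image_eq_integral_abs_deriv_smul
    MeasurableSet.univ (fun x _ => (Real.hasDerivAt_sigmoid x).hasDerivWithinAt)
    Real.sigmoid_injective.injOn]
  simp only [betaIntegrand_comp_sigmoid, setIntegral_univ]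

lemma sigmoid_cpow_mul_eq_cosh_rpow (a x : ℝ) :
    (Real.sigmoid x : ℂ) ^ (a / 2 : ℂ) * (1 - (Real.sigmoid x : ℂ)) ^ (a / 2 : ℂ) =
      ((2 * Real.cosh (x / 2)) ^ (-a) : ℝ) := by
  have hpos : 0 ≤ Real.sigmoid x := Real.sigmoid_nonneg x
  have hle : 0 ≤ 1 - Real.sigmoid x := sub_nonneg.2 (Real.sigmoid_le_one x)
  have hcosh : (0 : ℝ) ≤ 2 * Real.cosh (x / 2) := by positivity
  rw [← ofReal_one, ← ofReal_sub, ← mul_cpow_ofReal_nonneg hpos hle, ← ofReal_mul,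
    sigmoid_mul_one_sub_sigmoid, ← ofReal_ofNat, ← ofReal_div,
    ← ofReal_cpow (by positivity), ← Real.rpow_two, ← Real.rpow_neg hcosh, ← Real.rpow_mul hcosh]
  ring_nf

variable {a : ℝ}

lemma rpow_mul_mul_rpow_neg {b c : ℝ} (hb : 0 < b) (hc : 0 ≤ c) (a : ℝ) :
    b ^ a * (b * c) ^ (-a) = c ^ (-a) := by
  rw [Real.mul_rpow hb.le hc, ← mul_assoc, ← Real.rpow_add hb, add_neg_cancel, Real.rpow_zero,
    one_mul]

lemma integrable_cosh_half_rpow_neg (ha : 0 < a) :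
    Integrable fun x : ℝ => Real.cosh (x / 2) ^ (-a) := by
  have h := integrable_sigmoid_cpow_mul (u := a / 2) (v := a / 2) (by simpa) (by simpa)
  simp only [sigmoid_cpow_mul_eq_cosh_rpow] at h
  refine (h.re.const_mul ((2 : ℝ) ^ a)).congr (ae_of_all _ fun x => ?_)
  exact rpow_mul_mul_rpow_neg two_pos (Real.cosh_pos _).le a

lemma integral_cosh_rpow_neg (ha : 0 < a) :
    ∫ x : ℝ, Real.cosh x ^ (-a) = 2 ^ (a - 1) * Real.Gamma (a / 2) ^ 2 / Real.Gamma a := by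
  have hbeta := integral_sigmoid_cpow_mul (a / 2) (a / 2)
  simp only [sigmoid_cpow_mul_eq_cosh_rpow] at hbeta
  rw [betaIntegral_eq_Gamma_mul_div _ _ (by simpa) (by simpa), integral_complex_ofReal,
    add_halves, ← ofReal_ofNat, ← ofReal_div, Gamma_ofReal, Gamma_ofReal, ← ofReal_mul,
    ← ofReal_div, ofReal_inj] at hbeta
  calc ∫ x : ℝ, Real.cosh x ^ (-a)
      = ∫ x : ℝ, 2 ^ a * (2 * Real.cosh (2 * x / 2)) ^ (-a) := by
        simp [rpow_mul_mul_rpow_neg two_pos (Real.cosh_pos _).le]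
    _ = 2 ^ a * (2⁻¹ * ∫ x : ℝ, (2 * Real.cosh (x / 2)) ^ (-a)) := by
        rw [integral_const_mul,
          Measure.integral_comp_mul_left (fun x => (2 * Real.cosh (x / 2)) ^ (-a))]
        simp
    _ = 2 ^ (a - 1) * Real.Gamma (a / 2) ^ 2 / Real.Gamma a := by
        rw [hbeta, Real.rpow_sub_one two_ne_zero]
        ring

end Beta

section FourierIntegrand

/-- The integrand of the Fourier integral defining `G_p` in its holomorphic form, where `α` is the
exponent of `l / sinh l` and `4 (p - 1) r e^{iθ} = |z|² + 4 i σ`. -/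
def fourierIntegrand (α r θ t : ℝ) (w : ℂ) : ℂ :=
  sinhc w ^ (-α : ℂ) * cexp (-(r * cosh (w + θ * I) / sinhc w / t))

variable {α r θ t : ℝ} {w : ℂ}

lemma cosh_add_mul_I_div_sinhc (θ : ℝ) (hw : |w.im| ≤ π / 2) :
    cosh (w + θ * I) / sinhc w = Real.cos θ * (cosh w / sinhc w) + Real.sin θ * (w * I) := by
  have hne := sinhc_ne_zero hw
  rw [cosh_add, cosh_mul_I, sinh_mul_I, ← sinhc_mul_self w, ofReal_cos, ofReal_sin]
  field_simp

lemma neg_pi_div_two_le_re_cosh_add_mul_I_div_sinhc (hθ : |θ| ≤ π / 2) (hw : |w.im| ≤ π / 2) :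
    -(π / 2) ≤ (cosh (w + θ * I) / sinhc w).re := by
  have hcos : 0 ≤ Real.cos θ * (cosh w / sinhc w).re :=
    mul_nonneg (Real.cos_nonneg_of_mem_Icc (abs_le.1 hθ)) (re_cosh_div_sinhc_nonneg hw)
  have hsin : Real.sin θ * w.im ≤ π / 2 :=
    calc Real.sin θ * w.im ≤ |Real.sin θ| * |w.im| := by rw [← abs_mul]; exact le_abs_self _
      _ ≤ 1 * (π / 2) := by gcongr; exact Real.abs_sin_le_one θ
      _ = π / 2 := one_mul _
  rw [cosh_add_mul_I_div_sinhc θ hw, add_re, re_ofReal_mul, re_ofReal_mul, mul_I_re]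
  linarith

lemma norm_fourierIntegrand_le (hα : 0 ≤ α) (hr : 0 ≤ r) (ht : 0 ≤ t) (hθ : |θ| ≤ π / 2)
    (hw : |w.im| ≤ π / 2) :
    ‖fourierIntegrand α r θ t w‖ ≤
      (Real.cosh (w.re / 2) / 8) ^ (-α) * Real.exp (r / t * (π / 2)) := by
  have hexp : (-(r * cosh (w + θ * I) / sinhc w / t)).re ≤ r / t * (π / 2) := by
    have hre : (-(r * cosh (w + θ * I) / sinhc w / t)).re =
        r / t * -(cosh (w + θ * I) / sinhc w).re := by
      rw [mul_div_assoc, neg_re, div_ofReal_re, re_ofReal_mul]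
      ring
    rw [hre]
    gcongr
    linarith [neg_pi_div_two_le_re_cosh_add_mul_I_div_sinhc hθ hw]
  rw [fourierIntegrand, norm_mul, norm_exp, ← ofReal_neg, norm_cpow_real]
  refine mul_le_mul (Real.rpow_le_rpow_of_nonpos (by positivity) ?_ (by linarith))
    (Real.exp_le_exp.2 hexp) (by positivity) (by positivity)
  exact (cosh_half_le_re_sinhc hw).trans (re_le_norm _)

lemma differentiableAt_fourierIntegrand (hw : |w.im| ≤ π / 2) :
    DifferentiableAt ℂ (fourierIntegrand α r θ t) w := by
  have hne := sinhc_ne_zero hw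
  have hS := differentiable_sinhc w
  have hexp : DifferentiableAt ℂ (fun w => cexp (-(r * cosh (w + θ * I) / sinhc w / t))) w := by
    fun_prop (disch := assumption)
  exact (hS.cpow_const (Or.inl (re_sinhc_pos hw))).mul hexp

lemma integrable_cosh_half_div_rpow_neg (hα : 0 < α) :
    Integrable fun x : ℝ => (Real.cosh (x / 2) / 8) ^ (-α) := by
  simp_rw [Real.div_rpow (Real.cosh_pos _).le (by norm_num : (0 : ℝ) ≤ 8)]
  exact (integrable_cosh_half_rpow_neg hα).div_const _

lemma abs_le_cosh (x : ℝ) : |x| ≤ Real.cosh x :=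
  calc |x| ≤ Real.sinh |x| := Real.self_le_sinh_iff.2 (abs_nonneg x)
    _ ≤ Real.cosh |x| := (Real.sinh_lt_cosh _).le
    _ = Real.cosh x := Real.cosh_abs x

lemma tendsto_cosh_half_div_rpow_neg (hα : 0 < α) :
    Tendsto (fun x : ℝ => (Real.cosh (x / 2) / 8) ^ (-α)) (cocompact ℝ) (𝓝 0) := by
  refine (tendsto_rpow_neg_atTop hα).comp <|
    tendsto_atTop_mono (f := fun x : ℝ => |x| / 16) (fun x => ?_)
      ((tendsto_norm_cocompact_atTop (E := ℝ)).atTop_div_const (by norm_num))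
  have h := abs_le_cosh (x / 2)
  rw [abs_div, abs_two] at h
  linarith

lemma integrable_fourierIntegrand (hα : 0 < α) (hr : 0 ≤ r) (ht : 0 ≤ t) (hθ : |θ| ≤ π / 2) :
    Integrable fun l : ℝ => fourierIntegrand α r θ t l := by
  have hreal : ∀ l : ℝ, |(l : ℂ).im| ≤ π / 2 := fun l => by simpa using by positivity
  have hcont : Continuous fun l : ℝ => fourierIntegrand α r θ t l :=
    continuous_iff_continuousAt.2 fun l =>
      (differentiableAt_fourierIntegrand (hreal l)).continuousAt.comp (by fun_prop)
  exact ((integrable_cosh_half_div_rpow_neg hα).mul_const _).mono' hcont.aestronglyMeasurable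
    (ae_of_all _ fun l => norm_fourierIntegrand_le hα.le hr ht hθ (hreal l))

lemma integral_fourierIntegrand_eq (hα : 0 < α) (hr : 0 ≤ r) (ht : 0 ≤ t) (hθ : |θ| ≤ π / 2) :
    ∫ l : ℝ, fourierIntegrand α r θ t l = ∫ x : ℝ, fourierIntegrand α r θ t (x - θ * I) := by
  have hstrip : ∀ w : ℂ, w.im ∈ [[0, -θ]] → |w.im| ≤ π / 2 := fun w hw => by
    simpa using (abs_sub_left_of_mem_uIcc hw).trans (by simpa)
  have h := integral_eq_integral_add_mul_I (y := -θ)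
    (fun w hw => (differentiableAt_fourierIntegrand (hstrip w hw)).differentiableWithinAt)
    (fun w hw => norm_fourierIntegrand_le hα.le hr ht hθ (hstrip w hw))
    ((integrable_cosh_half_div_rpow_neg hα).mul_const _)
    (by simpa using (tendsto_cosh_half_div_rpow_neg hα).mul_const (Real.exp (r / t * (π / 2))))
  simpa [sub_eq_add_neg] using h

lemma fourierIntegrand_sub_mul_I (α r θ t x : ℝ) :
    fourierIntegrand α r θ t (x - θ * I) = sinhc (x - θ * I) ^ (-α : ℂ) *
      cexp (-(r * Real.cosh x / sinhc (x - θ * I) / t)) := by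
  rw [fourierIntegrand, sub_add_cancel, ofReal_cosh]

lemma abs_im_sub_mul_I_le (hθ : |θ| ≤ π / 2) (x : ℝ) : |((x : ℂ) - θ * I).im| ≤ π / 2 := by
  simpa using hθ

lemma cpow_mul_ofReal_div_cpow {a : ℝ} (ha : 0 < a) {z : ℂ} (hz : z ∈ slitPlane) (s : ℂ) :
    z ^ s * (a / z) ^ s = (a : ℂ) ^ s := by
  have hz0 := slitPlane_ne_zero hz
  have ha0 : (a : ℂ) ≠ 0 := ofReal_ne_zero.2 ha.ne'
  rw [cpow_def_of_ne_zero hz0, cpow_def_of_ne_zero (div_ne_zero ha0 hz0), cpow_def_of_ne_zero ha0,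
    div_eq_mul_inv, log_ofReal_mul ha (inv_ne_zero hz0), log_inv _ (slitPlane_arg_ne_pi hz),
    ← exp_add, ofReal_log ha.le]
  ring_nf

lemma re_ofReal_div (a : ℝ) (z : ℂ) : (a / z : ℂ).re = a * z.re / ‖z‖ ^ 2 := by
  simp [div_re, normSq_eq_norm_sq]

lemma norm_mul_re_ofReal_div {a : ℝ} {z : ℂ} (hz : z ≠ 0) :
    ‖z‖ * (a / z : ℂ).re = a * z.re / ‖z‖ := by
  rw [re_ofReal_div]
  field_simp

lemma re_mul_cosh_div_sinhc_pos (hr : 0 < r) (hw : |w.im| ≤ π / 2) (x : ℝ) :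
    0 < ((r * Real.cosh x : ℝ) / sinhc w).re := by
  have := re_sinhc_pos hw
  have := sinhc_ne_zero hw
  rw [re_ofReal_div]
  positivity

-- The contour shift makes the numerator of the exponent real, so that the Gamma integral in `t`
-- produces a power of `sinhc` which cancels the prefactor.
lemma hasMellin_fourierIntegrand_sub_mul_I (hα : 0 < α) (hr : 0 < r) (hθ : |θ| ≤ π / 2) (x : ℝ) :
    HasMellin (fun t => fourierIntegrand α r θ t (x - θ * I)) (-α)
      ((r * Real.cosh x) ^ (-α) * Real.Gamma α : ℝ) := by
  have him := abs_im_sub_mul_I_le hθ x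
  have ha : 0 < r * Real.cosh x := by positivity
  have h := hasMellin_const_smul
    (hasMellin_cexp_neg_div (s := α) (by simpa) (re_mul_cosh_div_sinhc_pos hr him x)).1
    (sinhc (x - θ * I) ^ (-α : ℂ))
  rw [(hasMellin_cexp_neg_div (by simpa) (re_mul_cosh_div_sinhc_pos hr him x)).2, smul_eq_mul,
    ← mul_assoc, cpow_mul_ofReal_div_cpow ha (Or.inl (re_sinhc_pos him)), Gamma_ofReal,
    ← ofReal_neg, ← ofReal_cpow ha.le, ← ofReal_mul] at h
  simpa only [fourierIntegrand_sub_mul_I, smul_eq_mul, ofReal_mul, ofReal_neg] using h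

lemma mul_cosh_half_le_norm_mul_re (hr : 0 ≤ r) (hθ : |θ| ≤ π / 2) (x : ℝ) :
    r * (Real.cosh (x / 2) / 8) ≤
      ‖sinhc (x - θ * I)‖ * ((r * Real.cosh x : ℝ) / sinhc (x - θ * I)).re := by
  have him := abs_im_sub_mul_I_le hθ x
  have hre : ((x : ℂ) - θ * I).re = x := by simp
  have hlower := cosh_half_le_re_sinhc him
  have hupper := norm_sinhc_le (x - θ * I)
  rw [hre] at hlower hupper
  have hnorm : 0 < ‖sinhc (x - θ * I)‖ := norm_pos_iff.2 (sinhc_ne_zero him)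
  rw [norm_mul_re_ofReal_div (sinhc_ne_zero him), le_div_iff₀ hnorm, mul_assoc, mul_assoc,
    mul_comm (Real.cosh x)]
  exact mul_le_mul_of_nonneg_left (mul_le_mul hlower hupper hnorm.le (re_sinhc_pos him).le) hr

lemma integral_norm_fourierIntegrand_sub_mul_I_le (hα : 0 < α) (hr : 0 < r) (hθ : |θ| ≤ π / 2)
    (x : ℝ) :
    ∫ t in Ioi (0 : ℝ), ‖(t : ℂ) ^ (-α - 1 : ℂ) • fourierIntegrand α r θ t (x - θ * I)‖ ≤
      (r * (Real.cosh (x / 2) / 8)) ^ (-α) * Real.Gamma α := by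
  have hpos := re_mul_cosh_div_sinhc_pos hr (abs_im_sub_mul_I_le hθ x) x
  have hint := integral_norm_cpow_smul_cexp_neg_div (s := α) (by simpa) hpos
  calc ∫ t in Ioi (0 : ℝ), ‖(t : ℂ) ^ (-α - 1 : ℂ) • fourierIntegrand α r θ t (x - θ * I)‖
      = ‖sinhc (x - θ * I)‖ ^ (-α) *
          (((r * Real.cosh x : ℝ) / sinhc (x - θ * I)).re ^ (-α) * Real.Gamma α) := by
        rw [← ofReal_re α, ← hint, ← integral_const_mul]
        congr with t
        rw [fourierIntegrand_sub_mul_I, ofReal_re, ← norm_cpow_real, ← norm_mul, smul_eq_mul,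
          smul_eq_mul, mul_left_comm, ofReal_neg, ofReal_mul]
    _ = (‖sinhc (x - θ * I)‖ * ((r * Real.cosh x : ℝ) / sinhc (x - θ * I)).re) ^ (-α) *
          Real.Gamma α := by
        rw [Real.mul_rpow (norm_nonneg _) hpos.le, mul_assoc]
    _ ≤ (r * (Real.cosh (x / 2) / 8)) ^ (-α) * Real.Gamma α := by
        refine mul_le_mul_of_nonneg_right ?_ (Real.Gamma_pos_of_pos hα).le
        exact Real.rpow_le_rpow_of_nonpos (by positivity) (mul_cosh_half_le_norm_mul_re hr.le hθ x)
          (by linarith)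

lemma hasMellin_integral_fourierIntegrand (hα : 0 < α) (hr : 0 < r) (hθ : |θ| ≤ π / 2) :
    HasMellin (fun t => ∫ x : ℝ, fourierIntegrand α r θ t (x - θ * I)) (-α)
      (r ^ (-α) * (2 ^ (α - 1) * Real.Gamma (α / 2) ^ 2) : ℝ) := by
  have hmeas : Measurable fun q : ℝ × ℝ => fourierIntegrand α r θ q.1 (q.2 - θ * I) := by
    have := differentiable_sinhc.continuous.measurable
    unfold fourierIntegrand
    fun_prop
  have hbound : Integrable fun x : ℝ => (r * (Real.cosh (x / 2) / 8)) ^ (-α) * Real.Gamma α := by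
    simp_rw [fun x => Real.mul_rpow hr.le (by positivity : 0 ≤ Real.cosh (x / 2) / 8) (z := -α)]
    exact ((integrable_cosh_half_div_rpow_neg hα).const_mul _).mul_const _
  have hvalue : ∫ x : ℝ, (r * Real.cosh x) ^ (-α) * Real.Gamma α =
      r ^ (-α) * (2 ^ (α - 1) * Real.Gamma (α / 2) ^ 2) := by
    simp_rw [fun x => Real.mul_rpow hr.le (Real.cosh_pos x).le (z := -α)]
    rw [integral_mul_const, integral_const_mul, integral_cosh_rpow_neg hα, mul_assoc,
      div_mul_cancel₀ _ (Real.Gamma_pos_of_pos hα).ne']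
  rw [← hvalue, ← integral_complex_ofReal]
  exact hasMellin_integral hmeas.aestronglyMeasurable
    (hasMellin_fourierIntegrand_sub_mul_I hα hr hθ) hbound
    (integral_norm_fourierIntegrand_sub_mul_I_le hα hr hθ)

end FourierIntegrand

section Kernel

variable {n : ℕ} {p t : ℝ}

/-- The complex number `|z|² + 4 i σ` attached to the point `(z, σ)` of `ℍⁿ`, whose modulus is
`N(z, σ)²`. -/
def complexGauge (z : Horizontal n) (σ : ℝ) : ℂ := ⟨‖z‖ ^ 2, 4 * σ⟩

lemma complexGauge_ne_zero {z : Horizontal n} {σ : ℝ} (h : (z, σ) ≠ (0, 0)) :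
    complexGauge z σ ≠ 0 := by
  contrapose! h
  simpa [complexGauge, Complex.ext_iff] using h

lemma abs_arg_complexGauge_le (z : Horizontal n) (σ : ℝ) : |(complexGauge z σ).arg| ≤ π / 2 :=
  abs_arg_le_pi_div_two_iff.2 (sq_nonneg ‖z‖)

lemma norm_complexGauge (z : Horizontal n) (σ : ℝ) :
    ‖complexGauge z σ‖ = gauge z σ ^ (2 : ℝ) := by
  rw [gauge, ← Real.rpow_mul (by positivity), norm_eq_sqrt_sq_add_sq, Real.sqrt_eq_rpow,
    complexGauge, sq_abs]
  ring_nf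

lemma norm_mul_cosh_add_arg_mul_I (v w : ℂ) :
    ‖v‖ * cosh (w + v.arg * I) = v.re * cosh w + v.im * (sinh w * I) := by
  rw [cosh_add, cosh_mul_I, sinh_mul_I, ← ofReal_cos, ← ofReal_sin, ← norm_mul_cos_arg v,
    ← norm_mul_sin_arg v]
  push_cast
  ring

/-- The exponent `α = (Q - p) / (2 (p - 1))` of `|l| / sinh |l|` in the kernel `G_p`. -/
def kernelExponent (n : ℕ) (p : ℝ) : ℝ := (homDim n - p) / (2 * (p - 1))

lemma kernelExponent_pos (hp : 1 < p) (hpQ : p < homDim n) : 0 < kernelExponent n p :=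
  div_pos (sub_pos.2 hpQ) (mul_pos two_pos (sub_pos.2 hp))

lemma abs_div_sinh_abs (l : ℝ) : |l| / Real.sinh |l| = l / Real.sinh l := by
  rcases abs_choice l with h | h <;> simp [h, neg_div_neg_eq]

lemma abs_div_tanh_abs (l : ℝ) : |l| / Real.tanh |l| = l / Real.tanh l := by
  rcases abs_choice l with h | h <;> simp [h, neg_div_neg_eq]

lemma sinhc_ofReal_cpow_neg {l : ℝ} (hl : l ≠ 0) (a : ℝ) :
    sinhc l ^ (-a : ℂ) = ((|l| / Real.sinh |l|) ^ a : ℝ) := by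
  have hS : sinhc l = (Real.sinh l / l : ℝ) := by
    rw [sinhc_of_ne_zero (ofReal_ne_zero.2 hl), ofReal_div, ofReal_sinh]
  have hpos : 0 < Real.sinh l / l := by
    have h := re_sinhc_pos (w := l) (by simpa using by positivity)
    rwa [hS, ofReal_re] at h
  rw [hS, abs_div_sinh_abs, ← ofReal_neg, ← ofReal_cpow hpos.le, Real.rpow_neg hpos.le,
    ← Real.inv_rpow hpos.le, inv_div]

lemma kernelIntegrand_eq_fourierIntegrand (p : ℝ) (z : Horizontal n) (σ t : ℝ) {l : ℝ}
    (hl : l ≠ 0) :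
    kernelIntegrand p z σ t l = fourierIntegrand (kernelExponent n p)
      (‖complexGauge z σ‖ / (4 * (p - 1))) (complexGauge z σ).arg t l := by
  have hsinh : sinh (l : ℂ) ≠ 0 := by
    rw [← ofReal_sinh, ofReal_ne_zero]
    exact Real.sinh_eq_zero.not.2 hl
  rw [kernelIntegrand, fourierIntegrand, sinhc_ofReal_cpow_neg hl, mul_right_comm, mul_comm,
    ofReal_exp, ← exp_add, kernelExponent, ofReal_div, div_mul_eq_mul_div,
    norm_mul_cosh_add_arg_mul_I, sinhc_of_ne_zero (ofReal_ne_zero.2 hl), abs_div_tanh_abs,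
    Real.tanh_eq_sinh_div_cosh, complexGauge]
  congr 2
  push_cast
  field_simp
  ring

lemma kernelIntegrand_ae_eq_fourierIntegrand (p : ℝ) (z : Horizontal n) (σ t : ℝ) :
    kernelIntegrand p z σ t =ᵐ[volume] fun l : ℝ => fourierIntegrand (kernelExponent n p)
      (‖complexGauge z σ‖ / (4 * (p - 1))) (complexGauge z σ).arg t l := by
  filter_upwards [compl_mem_ae_iff.2 (measure_singleton (0 : ℝ))] with l hl
  exact kernelIntegrand_eq_fourierIntegrand p z σ t hl

lemma integrable_kernelIntegrand (hp : 1 < p) (hpQ : p < homDim n) (z : Horizontal n) (σ : ℝ)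
    (ht : 0 ≤ t) : Integrable (kernelIntegrand p z σ t) :=
  (integrable_fourierIntegrand (kernelExponent_pos hp hpQ)
    (div_nonneg (norm_nonneg _) (by linarith)) ht (abs_arg_complexGauge_le z σ)).congr
    (kernelIntegrand_ae_eq_fourierIntegrand p z σ t).symm

lemma kernel_eq_cpow_smul_integral (hp : 1 < p) (hpQ : p < homDim n) (z : Horizontal n) (σ : ℝ)
    (ht : 0 ≤ t) :
    kernel p z σ t = (t : ℂ) ^ (-kernelExponent n p - 1 : ℂ) •
      ∫ x : ℝ, fourierIntegrand (kernelExponent n p) (‖complexGauge z σ‖ / (4 * (p - 1)))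
        (complexGauge z σ).arg t (x - (complexGauge z σ).arg * I) := by
  have hp1 : 0 < p - 1 := sub_pos.2 hp
  have hexp : -((homDim n + p - 2) / (2 * (p - 1))) = -kernelExponent n p - 1 := by
    rw [kernelExponent]
    field_simp
    ring
  rw [kernel, integral_congr_ae (kernelIntegrand_ae_eq_fourierIntegrand p z σ t),
    integral_fourierIntegrand_eq (kernelExponent_pos hp hpQ) (by positivity) ht
    (abs_arg_complexGauge_le z σ), hexp, ofReal_cpow ht, smul_eq_mul]
  push_cast
  rfl

lemma potentialConst_pos (hp : 1 < p) (hpQ : p < homDim n) : 0 < potentialConst n p := by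
  have hGamma := Real.Gamma_pos_of_pos (half_pos (kernelExponent_pos hp hpQ))
  have hp1 := Real.rpow_pos_of_pos (sub_pos.2 hp) (kernelExponent n p)
  exact mul_pos (mul_pos (by positivity) hp1) (pow_pos hGamma 2)

lemma potentialConst_mul_gauge_rpow (hp : 1 < p) (z : Horizontal n) (σ : ℝ) :
    potentialConst n p * gauge z σ ^ (-((homDim n - p) / (p - 1))) =
      (‖complexGauge z σ‖ / (4 * (p - 1))) ^ (-kernelExponent n p) *
        (2 ^ (kernelExponent n p - 1) * Real.Gamma (kernelExponent n p / 2) ^ 2) := by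
  have hp1 : 0 < p - 1 := sub_pos.2 hp
  have hgauge : gauge z σ ^ (-((homDim n - p) / (p - 1))) =
      ‖complexGauge z σ‖ ^ (-kernelExponent n p) := by
    rw [norm_complexGauge, ← Real.rpow_mul (by rw [gauge]; positivity), kernelExponent]
    congr 1
    field_simp
  have hfour : (4 : ℝ) ^ (-kernelExponent n p) = 2 ^ (-(2 * kernelExponent n p)) := by
    rw [show (4 : ℝ) = 2 ^ (2 : ℝ) by norm_num, ← Real.rpow_mul two_pos.le, mul_neg]
  have htwo : (2 : ℝ) ^ (3 * kernelExponent n p - 1) =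
      2 ^ (2 * kernelExponent n p) * 2 ^ (kernelExponent n p - 1) := by
    rw [← Real.rpow_add two_pos]
    ring_nf
  rw [hgauge, potentialConst, ← kernelExponent, htwo, Real.div_rpow (norm_nonneg _) (by positivity),
    Real.mul_rpow (by norm_num) hp1.le, hfour, Real.rpow_neg two_pos.le, Real.rpow_neg hp1.le]
  field_simp

end Kernel

end

end Heisenberg

open Heisenberg

theorem proposition4p1 (n : ℕ) (hn : 1 ≤ n) (p : ℝ) (hp : 1 < p)
    (hpQ : p < Heisenberg.homDim n) :
    0 < Heisenberg.potentialConst n p ∧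
    ∀ (z : Heisenberg.Horizontal n) (σ : ℝ), (z, σ) ≠ (0, 0) →
      (∀ t : ℝ, 0 < t → Integrable (Heisenberg.kernelIntegrand p z σ t)) ∧
      IntegrableOn (fun t : ℝ => Heisenberg.kernel p z σ t) (Ioi 0) ∧
      ∫ t in Ioi (0 : ℝ), Heisenberg.kernel p z σ t =
        ((Heisenberg.potentialConst n p
          * Heisenberg.gauge z σ ^ (-((Heisenberg.homDim n - p) / (p - 1))) : ℝ) : ℂ) := by
  refine ⟨potentialConst_pos hp hpQ, fun z σ hzσ => ?_⟩
  have hr : 0 < ‖complexGauge z σ‖ / (4 * (p - 1)) :=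
    div_pos (norm_pos_iff.2 (complexGauge_ne_zero hzσ)) (by linarith)
  obtain ⟨hconv, hvalue⟩ := hasMellin_integral_fourierIntegrand (kernelExponent_pos hp hpQ) hr
    (abs_arg_complexGauge_le z σ)
  have hkernel := fun t (ht : t ∈ Ioi (0 : ℝ)) =>
    kernel_eq_cpow_smul_integral hp hpQ z σ (le_of_lt ht)
  refine ⟨fun t ht => integrable_kernelIntegrand hp hpQ z σ ht.le,
    hconv.congr_fun (fun t ht => (hkernel t ht).symm) measurableSet_Ioi, ?_⟩
  rw [setIntegral_congr_fun measurableSet_Ioi hkernel, potentialConst_mul_gauge_rpow hp, ← hvalue,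
    mellin]
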